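/- Let $n\ge 0$, let $\mathbb U,\bar{\mathbb U}\subseteq\mathbb R$ be nonempty open (possibly unbounded) intervals, and let $p:\mathbb U\to\mathrm{Sym}_n(\mathbb R)$ and $\bar p:\bar{\mathbb U}\to\mathrm{Sym}_n(\mathbb R)$ be smooth maps into the symmetric real $n\times n$ matrices. Consider the Brinkmann metrics $$G=2\,du\,dv+x^Tp(u)x\,du^2-dx^Tdx\quad\text{on }\mathbb M=\mathbb U\times\mathbb R\times\mathbb R^n,$$ $$\bar G=2\,d\bar u\,d\bar v+\bar x^T\bar p(\bar u)\bar x\,d\bar u^2-d\bar x^Td\bar x\quad\text{on }\bar{\mathbb M}=\bar{\mathbb U}\times\mathbb R\times\mathbb R^n.$$ An isometry from $(\mathbb M,G)$ to $(\bar{\mathbb M},\bar G)$ is a bijective smooth map $\phi:\mathbb M\to\bar{\mathbb M}$ with smooth inverse such that $\phi^*\bar G=G$; an automorphism of $G$ is an isometry from $(\mathbb M,G)$ to itself. (1) There is an isometry from $(\mathbb M,G)$ to $(\bar{\mathbb M},\bar G)$ if and only if there are constants $a,u_0\in\mathbb R$ with $a\neq 0$ and a constant matrix $\gamma\in\operatorname{O}(n)$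 such that $\bar{\mathbb U}$ is the image of $\mathbb U$ under $u\mapsto a(u-u_0)$ and $$a^2\,\gamma^T\,\bar p\big(a(u-u_0)\big)\,\gamma=p(u)\qquad\text{for all }u\in\mathbb U.$$ (2) For any such $a,u_0,\gamma$, the map $\psi(u,v,x)=\big(a(u-u_0),\,v/a,\,\gamma x\big)$ is an isometry from $(\mathbb M,G)$ to $(\bar{\mathbb M},\bar G)$, and a map $\phi:\mathbb M\to\bar{\mathbb M}$ is an isometry if and only if $\phi=\psi\circ\alpha$ for some automorphism $\alpha$ of $G$. -/

import Mathlib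

open scoped ContDiff Matrix

namespace PlaneWave

/-- The coordinate space of triples `(u, v, x)` with `u, v ∈ ℝ` and `x ∈ ℝⁿ`. The Euclidean
structure on `ℝⁿ` is written with the dot product; the norm of this type is used only for
its topology and for differentiability. -/
abbrev Coord (n : ℕ) : Type := ℝ × ℝ × (Fin n → ℝ)

/-- The manifold `𝕄 = 𝕌 × ℝ × ℝⁿ`, as a subset of the coordinate space. -/
def domain (n : ℕ) (U : Set ℝ) : Set (Coord n) := {m | m.1 ∈ U}

/-- A (nonempty) open real interval, possibly unbounded. -/
structure IsOpenInterval (U : Set ℝ) : Prop where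
  isOpen : IsOpen U
  ordConnected : U.OrdConnected
  nonempty : U.Nonempty

/-- `p` is a symmetric matrix depending smoothly on `u ∈ U`. -/
structure IsProfile {n : ℕ} (U : Set ℝ) (p : ℝ → Matrix (Fin n) (Fin n) ℝ) : Prop where
  smooth : ∀ i j, ContDiffOn ℝ ∞ (fun u => p u i j) U
  symm : ∀ u ∈ U, (p u).IsSymm

/-- The Brinkmann metric `2 du dv + xᵀ p(u) x du² - dxᵀ dx`, as a symmetric bilinear form in
the tangent vectors `X`, `Y` at the point `m = (u, v, x)`. -/
def brinkmannMetric {n : ℕ} (p : ℝ → Matrix (Fin n) (Fin n) ℝ) (m X Y : Coord n) : ℝ :=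
  (X.1 * Y.2.1 + X.2.1 * Y.1) + (m.2.2 ⬝ᵥ (p m.1 *ᵥ m.2.2)) * (X.1 * Y.1) - X.2.2 ⬝ᵥ Y.2.2

/-- `φ` restricts to a smooth bijection of `M` onto `N` with smooth inverse. -/
structure IsDiffeoOn {n : ℕ} (φ : Coord n → Coord n) (M N : Set (Coord n)) : Prop where
  bijOn : Set.BijOn φ M N
  smooth : ContDiffOn ℝ ∞ φ M
  smooth_inverse : ∃ ψ : Coord n → Coord n, Set.InvOn ψ φ M N ∧ ContDiffOn ℝ ∞ ψ N

/-- `φ` (through its restriction to `U × ℝ × ℝⁿ`) is an isometry from `U × ℝ × ℝⁿ` with the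
Brinkmann metric of `p` to `U' × ℝ × ℝⁿ` with the Brinkmann metric of `p'`: a diffeomorphism
that pulls the second metric back to the first one. -/
structure IsIsometry {n : ℕ} (U : Set ℝ) (p : ℝ → Matrix (Fin n) (Fin n) ℝ)
    (U' : Set ℝ) (p' : ℝ → Matrix (Fin n) (Fin n) ℝ) (φ : Coord n → Coord n) : Prop where
  diffeo : IsDiffeoOn φ (domain n U) (domain n U')
  pullback : ∀ m ∈ domain n U, ∀ X Y : Coord n,
    brinkmannMetric p' (φ m) (fderiv ℝ φ m X) (fderiv ℝ φ m Y) = brinkmannMetric p m X Y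

/-- An automorphism: an isometry of a Brinkmann metric onto itself. -/
def IsAutomorphism {n : ℕ} (U : Set ℝ) (p : ℝ → Matrix (Fin n) (Fin n) ℝ)
    (α : Coord n → Coord n) : Prop :=
  IsIsometry U p U p α

/-- The map `(u, v, x) ↦ (a (u - u₀), v / a, γ x)`. -/
noncomputable def affineMap {n : ℕ} (a u₀ : ℝ) (γ : Matrix (Fin n) (Fin n) ℝ)
    (m : Coord n) : Coord n :=
  (a * (m.1 - u₀), m.2.1 / a, γ *ᵥ m.2.2)

/-- `a ≠ 0` and `γ ∈ O(n)` are constants such that `U'` is the image of `U` under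
`ū = a (u - u₀)` and `a² γᵀ p'(ū) γ = p(u)` for all `u ∈ U`. -/
structure IsMatch {n : ℕ} (U : Set ℝ) (p : ℝ → Matrix (Fin n) (Fin n) ℝ)
    (U' : Set ℝ) (p' : ℝ → Matrix (Fin n) (Fin n) ℝ)
    (a u₀ : ℝ) (γ : Matrix (Fin n) (Fin n) ℝ) : Prop where
  ne_zero : a ≠ 0
  orthogonal : γ ∈ Matrix.orthogonalGroup (Fin n) ℝ
  image_eq : (fun u => a * (u - u₀)) '' U = U'
  profile_eq : ∀ u ∈ U, a ^ 2 • (γᵀ * p' (a * (u - u₀)) * γ) = p u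

end PlaneWave

namespace PlaneWave

variable {n : ℕ} {U U' U'' : Set ℝ} {p p' p'' : ℝ → Matrix (Fin n) (Fin n) ℝ}
  {φ χ : Coord n → Coord n}

/-! Differentiating the pullback equation gives a Koszul formula (`IsIsometry.koszul`) for the
second derivative of an isometry φ. Since ∂_v̄ is parallel, the Hessian of the function ū ∘ φ
involves the source metric only (`IsIsometry.hessian_fst`), and it follows that c = ∂_v(ū ∘ φ) is
constant.

If c = 0, the gradient of ū ∘ φ is null and orthogonal to ∂_v, hence a constant multiple of ∂_v, so
ū ∘ φ = a(u - u₀) (`IsIsometry.exists_affine`). The Hessian of x̄ ∘ φ then lives only in the du²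
slot (`IsIsometry.hessian_snd`). Thus x̄ ∘ φ is affine in x with a constant linear part γ,
orthogonal by the pullback equation. Its second u-derivative does not depend on x, and comparing the
points x and 0 gives the relation between the profiles.

If c ≠ 0, symmetry considerations on ū ∘ φ force p = 0 (`IsIsometry.profile_eq_zero`), and linearity
along v-lines forces the target interval to be ℝ (`IsIsometry.eq_univ`). The same dichotomy for φ⁻¹
yields either a match to invert or two flat metrics over ℝ.

The description of all isometries is formal: compose with the inverse of the affine map. -/

theorem isOpen_domain (hU : IsOpen U) : IsOpen (domain n U) :=
  hU.preimage continuous_fst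

theorem convex_domain (hU : U.OrdConnected) : Convex ℝ (domain n U) :=
  hU.convex.linear_preimage (LinearMap.fst ℝ ℝ (ℝ × (Fin n → ℝ)))

theorem IsDiffeoOn.comp {M N O : Set (Coord n)} (hχ : IsDiffeoOn χ N O) (hφ : IsDiffeoOn φ M N) :
    IsDiffeoOn (χ ∘ φ) M O where
  bijOn := hχ.bijOn.comp hφ.bijOn
  smooth := hχ.smooth.comp hφ.smooth hφ.bijOn.mapsTo
  smooth_inverse := by
    obtain ⟨α, hα, sα⟩ := hφ.smooth_inverse
    obtain ⟨β, hβ, sβ⟩ := hχ.smooth_inverse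
    have hm : Set.MapsTo β O N := (Set.BijOn.symm hβ.symm hχ.bijOn).mapsTo
    exact ⟨α ∘ β, hα.comp hβ hφ.bijOn.mapsTo hm, sα.comp sβ hm⟩

theorem IsDiffeoOn.congr {M N : Set (Coord n)} (hφ : IsDiffeoOn φ M N) (h : Set.EqOn χ φ M) :
    IsDiffeoOn χ M N where
  bijOn := hφ.bijOn.congr h.symm
  smooth := hφ.smooth.congr h
  smooth_inverse := by
    obtain ⟨α, hα, sα⟩ := hφ.smooth_inverse
    have hm : Set.MapsTo α N M := (Set.BijOn.symm hα.symm hφ.bijOn).mapsTo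
    refine ⟨α, ⟨fun m hm => ?_, fun m hm' => ?_⟩, sα⟩
    · rw [h hm, hα.1 hm]
    · rw [h (hm hm'), hα.2 hm']

theorem IsIsometry.differentiableAt (hU : IsOpen U) (hφ : IsIsometry U p U' p' φ)
    {m : Coord n} (hm : m ∈ domain n U) : DifferentiableAt ℝ φ m :=
  (hφ.diffeo.smooth.contDiffAt ((isOpen_domain hU).mem_nhds hm)).differentiableAt (by simp)

theorem IsIsometry.comp (hU : IsOpen U) (hU' : IsOpen U') (hχ : IsIsometry U' p' U'' p'' χ)
    (hφ : IsIsometry U p U' p' φ) : IsIsometry U p U'' p'' (χ ∘ φ) where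
  diffeo := hχ.diffeo.comp hφ.diffeo
  pullback m hm X Y := by
    have hm' := hφ.diffeo.bijOn.mapsTo hm
    rw [fderiv_comp _ (hχ.differentiableAt hU' hm') (hφ.differentiableAt hU hm)]
    simp only [Function.comp, ContinuousLinearMap.comp_apply]
    rw [hχ.pullback _ hm', hφ.pullback _ hm]

/-- Because the domain is open, the ambient `fderiv` at its points depends only on values inside it.
-/
theorem IsIsometry.congr (hU : IsOpen U) (hφ : IsIsometry U p U' p' φ)
    (h : Set.EqOn χ φ (domain n U)) : IsIsometry U p U' p' χ where
  diffeo := hφ.diffeo.congr h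
  pullback m hm X Y := by
    rw [(h.eventuallyEq_of_mem ((isOpen_domain hU).mem_nhds hm)).fderiv_eq, h hm]
    exact hφ.pullback m hm X Y

/-- The inverse of an isometry is an isometry, and the differentials are mutually inverse. -/
theorem IsIsometry.exists_inverse (hU : IsOpen U) (hU' : IsOpen U')
    (hφ : IsIsometry U p U' p' φ) :
    ∃ ψ, IsIsometry U' p' U p ψ ∧ Set.InvOn ψ φ (domain n U) (domain n U') ∧
      ∀ m ∈ domain n U, ∀ Y, fderiv ℝ φ m (fderiv ℝ ψ (φ m) Y) = Y := by
  obtain ⟨ψ, hinv, hs⟩ := hφ.diffeo.smooth_inverse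
  have hb := Set.BijOn.symm hinv.symm hφ.diffeo.bijOn
  have key : ∀ q ∈ domain n U', ∀ Y, fderiv ℝ φ (ψ q) (fderiv ℝ ψ q Y) = Y := by
    intro q hq Y
    have h1 := hφ.differentiableAt hU (hb.mapsTo hq)
    have h2 : DifferentiableAt ℝ ψ q :=
      (hs.contDiffAt ((isOpen_domain hU').mem_nhds hq)).differentiableAt (by simp)
    have h3 : fderiv ℝ (φ ∘ ψ) q = fderiv ℝ id q :=
      (Set.EqOn.eventuallyEq_of_mem (s := domain n U') (fun x hx => hinv.2 hx)
        ((isOpen_domain hU').mem_nhds hq)).fderiv_eq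
    rw [fderiv_comp _ h1 h2, fderiv_id] at h3
    exact congrArg (fun L : Coord n →L[ℝ] Coord n => L Y) h3
  refine ⟨ψ, ⟨⟨hb, hs, φ, hinv.symm, hφ.diffeo.smooth⟩, fun q hq X Y => ?_⟩, hinv, fun m hm Y => ?_⟩
  · have := hφ.pullback _ (hb.mapsTo hq) (fderiv ℝ ψ q X) (fderiv ℝ ψ q Y)
    rw [key q hq, key q hq, hinv.2 hq] at this
    exact this.symm
  · have := key _ (hφ.diffeo.bijOn.mapsTo hm) Y
    rwa [hinv.1 hm] at this

/-! ### The affine map of a match -/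

theorem hasFDerivAt_affineMap (a u₀ : ℝ) (γ : Matrix (Fin n) (Fin n) ℝ) (m : Coord n) :
    ∃ L : Coord n →L[ℝ] Coord n, HasFDerivAt (affineMap a u₀ γ) L m ∧
      ∀ X, L X = (a * X.1, X.2.1 / a, γ *ᵥ X.2.2) := by
  let p1 : Coord n →L[ℝ] ℝ := ContinuousLinearMap.fst ℝ _ _
  let p2 : Coord n →L[ℝ] ℝ × (Fin n → ℝ) := ContinuousLinearMap.snd ℝ _ _
  let L : Coord n →L[ℝ] Coord n :=
    (a • p1).prod ((a⁻¹ • (ContinuousLinearMap.fst ℝ _ _ ∘L p2)).prod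
      (γ.mulVecLin.toContinuousLinearMap ∘L (ContinuousLinearMap.snd ℝ _ _ ∘L p2)))
  have hL : ∀ X, L X = (a * X.1, X.2.1 / a, γ *ᵥ X.2.2) := fun X => by
    simp [L, p1, p2, div_eq_inv_mul]
  refine ⟨L, ?_, hL⟩
  have h : affineMap a u₀ γ = fun m => L m + (-(a * u₀), 0, 0) := by
    funext m
    rw [hL]
    simp [affineMap, sub_eq_add_neg, mul_add]
  rw [h]
  exact L.hasFDerivAt.add_const _

theorem fderiv_affineMap (a u₀ : ℝ) (γ : Matrix (Fin n) (Fin n) ℝ) (m X : Coord n) :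
    fderiv ℝ (affineMap a u₀ γ) m X = (a * X.1, X.2.1 / a, γ *ᵥ X.2.2) := by
  obtain ⟨L, h, hL⟩ := hasFDerivAt_affineMap a u₀ γ m
  rw [h.fderiv, hL]

theorem contDiff_affineMap (a u₀ : ℝ) (γ : Matrix (Fin n) (Fin n) ℝ) :
    ContDiff ℝ ∞ (affineMap a u₀ γ) := by
  have h : ContDiff ℝ ∞ (fun x : Coord n => γ *ᵥ x.2.2) :=
    γ.mulVecLin.toContinuousLinearMap.contDiff.comp (by fun_prop : ContDiff ℝ ∞ fun x : Coord n => x.2.2)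
  exact ContDiff.prodMk (by fun_prop) (ContDiff.prodMk (by fun_prop) h)

/-- Solving ū = a(u - u₀) gives u = a⁻¹(ū + a u₀), whence the shift -(a u₀). Conjugating the profile
relation by γ inverts it. -/
theorem IsMatch.symm {a u₀ : ℝ} {γ : Matrix (Fin n) (Fin n) ℝ} (h : IsMatch U p U' p' a u₀ γ) :
    IsMatch U' p' U p a⁻¹ (-(a * u₀)) γᵀ := by
  have ha := h.ne_zero
  have e : ∀ u, a⁻¹ * (a * (u - u₀) - -(a * u₀)) = u := fun u => by field_simp; ring
  have o1 : γᵀ * γ = 1 := (Matrix.mem_orthogonalGroup_iff' _ _).1 h.orthogonal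
  have o2 : γ * γᵀ = 1 := (Matrix.mem_orthogonalGroup_iff _ _).1 h.orthogonal
  refine ⟨inv_ne_zero ha, (Matrix.mem_orthogonalGroup_iff _ _).2 (by simpa using o1), ?_, ?_⟩
  · rw [← h.image_eq, Set.image_image]
    simp only [e, Set.image_id']
  · rw [← h.image_eq]
    rintro _ ⟨u, hu, rfl⟩
    simp only [e]
    rw [← h.profile_eq u hu, Matrix.transpose_transpose, Matrix.mul_smul, Matrix.smul_mul, smul_smul]
    rw [show γ * (γᵀ * p' (a * (u - u₀)) * γ) * γᵀ = (γ * γᵀ) * p' (a * (u - u₀)) * (γ * γᵀ) by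
      simp only [Matrix.mul_assoc], o2, Matrix.one_mul, Matrix.mul_one, inv_pow,
      inv_mul_cancel₀ (pow_ne_zero 2 ha), one_smul]

theorem IsMatch.affineMap_inverse {a u₀ : ℝ} {γ : Matrix (Fin n) (Fin n) ℝ}
    (h : IsMatch U p U' p' a u₀ γ) (m : Coord n) :
    affineMap a⁻¹ (-(a * u₀)) γᵀ (affineMap a u₀ γ m) = m := by
  have ha := h.ne_zero
  have o1 : γᵀ * γ = 1 := (Matrix.mem_orthogonalGroup_iff' _ _).1 h.orthogonal
  refine Prod.ext ?_ (Prod.ext ?_ ?_)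
  · simp only [affineMap]; field_simp; ring
  · simp only [affineMap]; field_simp
  · simp only [affineMap]; rw [Matrix.mulVec_mulVec, o1, Matrix.one_mulVec]

theorem IsMatch.affineMap_inverse' {a u₀ : ℝ} {γ : Matrix (Fin n) (Fin n) ℝ}
    (h : IsMatch U p U' p' a u₀ γ) (m : Coord n) :
    affineMap a u₀ γ (affineMap a⁻¹ (-(a * u₀)) γᵀ m) = m := by
  have ha := h.ne_zero
  have o2 : γ * γᵀ = 1 := (Matrix.mem_orthogonalGroup_iff _ _).1 h.orthogonal
  refine Prod.ext ?_ (Prod.ext ?_ ?_)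
  · simp only [affineMap]; field_simp; ring
  · simp only [affineMap]; field_simp
  · simp only [affineMap]; rw [Matrix.mulVec_mulVec, o2, Matrix.one_mulVec]

theorem IsMatch.mapsTo {a u₀ : ℝ} {γ : Matrix (Fin n) (Fin n) ℝ}
    (h : IsMatch U p U' p' a u₀ γ) :
    Set.MapsTo (affineMap a u₀ γ) (domain n U) (domain n U') := fun m hm => by
  change a * (m.1 - u₀) ∈ U'
  rw [← h.image_eq]
  exact ⟨m.1, hm, rfl⟩

theorem mulVec_dotProduct_mulVec (γ : Matrix (Fin n) (Fin n) ℝ) (x y : Fin n → ℝ) :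
    (γ *ᵥ x) ⬝ᵥ y = x ⬝ᵥ (γᵀ *ᵥ y) := by
  rw [Matrix.dotProduct_mulVec, Matrix.vecMul_transpose]

/-- The factors a and 1/a cancel in du dv, orthogonality preserves dxᵀdx, and the profile relation
matches the du² coefficients. -/
theorem IsMatch.isIsometry {a u₀ : ℝ} {γ : Matrix (Fin n) (Fin n) ℝ}
    (h : IsMatch U p U' p' a u₀ γ) : IsIsometry U p U' p' (affineMap a u₀ γ) where
  diffeo :=
    have hinv : Set.InvOn (affineMap a⁻¹ (-(a * u₀)) γᵀ) (affineMap a u₀ γ)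
        (domain n U) (domain n U') :=
      ⟨fun m _ => h.affineMap_inverse m, fun m _ => h.affineMap_inverse' m⟩
    ⟨hinv.bijOn h.mapsTo h.symm.mapsTo, (contDiff_affineMap _ _ _).contDiffOn, _, hinv,
      (contDiff_affineMap _ _ _).contDiffOn⟩
  pullback m hm X Y := by
    have ha := h.ne_zero
    have o1 : γᵀ * γ = 1 := (Matrix.mem_orthogonalGroup_iff' _ _).1 h.orthogonal
    simp only [fderiv_affineMap, brinkmannMetric, affineMap]
    rw [← h.profile_eq m.1 hm, mulVec_dotProduct_mulVec, mulVec_dotProduct_mulVec,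
      Matrix.mulVec_mulVec, Matrix.mulVec_mulVec, Matrix.mulVec_mulVec, o1, Matrix.one_mulVec,
      Matrix.smul_mulVec, dotProduct_smul, smul_eq_mul, Matrix.mul_assoc]
    field_simp

/-! ### The metric as a constant form plus a potential. -/

/-- The coefficient `xᵀ p(u) x` of `du²`. -/
def potential (p : ℝ → Matrix (Fin n) (Fin n) ℝ) (m : Coord n) : ℝ :=
  m.2.2 ⬝ᵥ (p m.1 *ᵥ m.2.2)

/-- The constant part `2 du dv - dxᵀ dx` of the metric. -/
noncomputable def flatForm (n : ℕ) : Coord n →L[ℝ] Coord n →L[ℝ] ℝ :=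
  (LinearMap.mk₂ ℝ (fun X Y : Coord n => X.1 * Y.2.1 + X.2.1 * Y.1 - X.2.2 ⬝ᵥ Y.2.2)
    (fun _ _ _ => by simp; ring) (fun _ _ _ => by simp; ring)
    (fun _ _ _ => by simp; ring) (fun _ _ _ => by simp; ring)).toContinuousBilinearMap

theorem flatForm_apply (X Y : Coord n) :
    flatForm n X Y = X.1 * Y.2.1 + X.2.1 * Y.1 - X.2.2 ⬝ᵥ Y.2.2 := rfl

/-- Isolates the dependence on the point in one scalar, so derivatives of the metric are derivatives
of the potential. -/
theorem brinkmannMetric_eq (m X Y : Coord n) :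
    brinkmannMetric p m X Y = flatForm n X Y + potential p m * (X.1 * Y.1) := by
  simp only [brinkmannMetric, flatForm_apply, potential]; ring

theorem brinkmannMetric_comm (m X Y : Coord n) :
    brinkmannMetric p m X Y = brinkmannMetric p m Y X := by
  simp only [brinkmannMetric, dotProduct_comm X.2.2]; ring

theorem brinkmannMetric_dv (m Y : Coord n) :
    brinkmannMetric p m Y (0, 1, 0) = Y.1 := by
  simp [brinkmannMetric]

theorem brinkmannMetric_dx (m Y : Coord n) (ζ : Fin n → ℝ) :
    brinkmannMetric p m Y (0, 0, ζ) = -(Y.2.2 ⬝ᵥ ζ) := by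
  simp [brinkmannMetric]

theorem IsProfile.differentiableAt_potential (hU : IsOpen U) (hp : IsProfile U p) {m : Coord n}
    (hm : m ∈ domain n U) : DifferentiableAt ℝ (potential p) m := by
  have h : ∀ i j, DifferentiableAt ℝ (fun m : Coord n => p m.1 i j) m := fun i j =>
    (((hp.smooth i j).contDiffAt (hU.mem_nhds hm)).differentiableAt (by simp)).comp m
      differentiableAt_fst
  change DifferentiableAt ℝ (fun m : Coord n => ∑ i, m.2.2 i * ∑ j, p m.1 i j * m.2.2 j) m
  have hx : ∀ i, DifferentiableAt ℝ (fun m : Coord n => m.2.2 i) m := fun i => by fun_prop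
  exact DifferentiableAt.fun_sum fun i _ =>
    (hx i).mul (DifferentiableAt.fun_sum fun j _ => (h i j).mul (hx j))

/-- The derivative of the potential along a level set of `u`. -/
theorem IsProfile.fderiv_potential (hU : IsOpen U) (hp : IsProfile U p) {m : Coord n}
    (hm : m ∈ domain n U) (Z : Coord n) (hZ : Z.1 = 0) :
    fderiv ℝ (potential p) m Z = 2 * (Z.2.2 ⬝ᵥ (p m.1 *ᵥ m.2.2)) := by
  have hl : HasDerivAt (fun t : ℝ => m + t • Z) Z 0 := by
    simpa using ((hasDerivAt_id (0 : ℝ)).smul_const Z).const_add m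
  have h1 := ((hp.differentiableAt_potential hU hm).hasFDerivAt.comp_hasDerivAt_of_eq 0 hl
    (by simp))
  have hs : m.2.2 ⬝ᵥ (p m.1 *ᵥ Z.2.2) = Z.2.2 ⬝ᵥ (p m.1 *ᵥ m.2.2) := by
    rw [dotProduct_comm, mulVec_dotProduct_mulVec, (hp.symm _ hm).eq]
  -- As u is fixed along this line, the potential is quadratic in t and no derivative of p enters.
  have h2 : potential p ∘ (fun t : ℝ => m + t • Z) = fun t : ℝ => potential p m +
      (t * (2 * (Z.2.2 ⬝ᵥ (p m.1 *ᵥ m.2.2))) + t ^ 2 * (Z.2.2 ⬝ᵥ (p m.1 *ᵥ Z.2.2))) := by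
    funext t
    simp only [potential, Function.comp, Prod.fst_add, Prod.smul_fst, hZ, Prod.snd_add,
      Prod.smul_snd, mul_zero, add_zero, Matrix.mulVec_add, Matrix.mulVec_smul, add_dotProduct,
      dotProduct_add, smul_dotProduct, dotProduct_smul, smul_eq_mul, hs]
    ring
  have h3 : HasDerivAt (fun t : ℝ => potential p m +
      (t * (2 * (Z.2.2 ⬝ᵥ (p m.1 *ᵥ m.2.2))) + t ^ 2 * (Z.2.2 ⬝ᵥ (p m.1 *ᵥ Z.2.2))))
      (2 * (Z.2.2 ⬝ᵥ (p m.1 *ᵥ m.2.2))) 0 := by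
    have := (((hasDerivAt_id (0 : ℝ)).mul_const (2 * (Z.2.2 ⬝ᵥ (p m.1 *ᵥ m.2.2)))).add
      (((hasDerivAt_id (0 : ℝ)).pow 2).mul_const (Z.2.2 ⬝ᵥ (p m.1 *ᵥ Z.2.2)))).const_add
        (potential p m)
    simpa using this
  rw [h2] at h1
  exact h1.unique h3

/-! ### Second derivatives of isometries and the Koszul formula. -/

theorem IsIsometry.contDiffAt (hU : IsOpen U) (hφ : IsIsometry U p U' p' φ)
    {m : Coord n} (hm : m ∈ domain n U) : ContDiffAt ℝ ∞ φ m :=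
  hφ.diffeo.smooth.contDiffAt ((isOpen_domain hU).mem_nhds hm)

theorem IsIsometry.differentiableAt_fderiv (hU : IsOpen U) (hφ : IsIsometry U p U' p' φ)
    {m : Coord n} (hm : m ∈ domain n U) : DifferentiableAt ℝ (fderiv ℝ φ) m :=
  have h : (1 + 1 : WithTop ℕ∞) ≤ ∞ := by
    rw [one_add_one_eq_two]
    exact WithTop.coe_le_coe.2 (le_top : (2 : ℕ∞) ≤ ⊤)
  ((hφ.contDiffAt hU hm).fderiv_right h).differentiableAt one_ne_zero

theorem IsIsometry.hasFDerivAt_apply (hU : IsOpen U) (hφ : IsIsometry U p U' p' φ)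
    {m : Coord n} (hm : m ∈ domain n U) (X : Coord n) :
    HasFDerivAt (fun m => fderiv ℝ φ m X) ((fderiv ℝ (fderiv ℝ φ) m).flip X) m := by
  simpa using (hφ.differentiableAt_fderiv hU hm).hasFDerivAt.clm_apply (hasFDerivAt_const X m)

theorem IsIsometry.symm_second (hU : IsOpen U) (hφ : IsIsometry U p U' p' φ)
    {m : Coord n} (hm : m ∈ domain n U) (X Y : Coord n) :
    fderiv ℝ (fderiv ℝ φ) m X Y = fderiv ℝ (fderiv ℝ φ) m Y X :=
  ((hφ.contDiffAt hU hm).isSymmSndFDerivAt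
    (by simpa using WithTop.coe_le_coe.2 (le_top : (2 : ℕ∞) ≤ ⊤))).eq X Y

/-- The pullback equation, differentiated in the direction `Z`. -/
theorem IsIsometry.fderiv_pullback (hU : IsOpen U) (hU' : IsOpen U')
    (hp : IsProfile U p) (hp' : IsProfile U' p') (hφ : IsIsometry U p U' p' φ)
    {m : Coord n} (hm : m ∈ domain n U) (X Y Z : Coord n) :
    brinkmannMetric p' (φ m) (fderiv ℝ (fderiv ℝ φ) m Z X) (fderiv ℝ φ m Y) +
      brinkmannMetric p' (φ m) (fderiv ℝ φ m X) (fderiv ℝ (fderiv ℝ φ) m Z Y) +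
      fderiv ℝ (potential p') (φ m) (fderiv ℝ φ m Z) * ((fderiv ℝ φ m X).1 * (fderiv ℝ φ m Y).1) =
    fderiv ℝ (potential p) m Z * (X.1 * Y.1) := by
  have hX := hφ.hasFDerivAt_apply hU hm X
  have hY := hφ.hasFDerivAt_apply hU hm Y
  have h1 := (flatForm n).hasFDerivAt_of_bilinear hX hY
  have h2 := (((hp'.differentiableAt_potential hU' (hφ.diffeo.bijOn.mapsTo hm)).hasFDerivAt.comp m
    (hφ.differentiableAt hU hm).hasFDerivAt).mul (hX.fst.mul hY.fst))
  have h3 := (((hp.differentiableAt_potential hU hm).hasFDerivAt.mul_const (X.1 * Y.1)).const_add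
    (flatForm n X Y))
  have h4 := (h1.add h2).congr_of_eventuallyEq (f₁ := fun m => flatForm n X Y +
    potential p m * (X.1 * Y.1)) (by
      filter_upwards [(isOpen_domain hU).mem_nhds hm] with q hq
      have := hφ.pullback q hq X Y
      rw [brinkmannMetric_eq, brinkmannMetric_eq] at this
      exact this.symm)
  have h5 := congrArg (fun L : Coord n →L[ℝ] ℝ => L Z) (h3.unique h4)
  simp [ContinuousLinearMap.precompR, ContinuousLinearMap.precompL] at h5
  simp only [brinkmannMetric_eq]
  linarith

/-- The Koszul formula for the second derivative of an isometry. -/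
theorem IsIsometry.koszul (hU : IsOpen U) (hU' : IsOpen U')
    (hp : IsProfile U p) (hp' : IsProfile U' p') (hφ : IsIsometry U p U' p' φ)
    {m : Coord n} (hm : m ∈ domain n U) (X Y Z : Coord n) :
    2 * brinkmannMetric p' (φ m) (fderiv ℝ (fderiv ℝ φ) m X Y) (fderiv ℝ φ m Z) =
      fderiv ℝ (potential p) m X * (Y.1 * Z.1) + fderiv ℝ (potential p) m Y * (X.1 * Z.1) -
        fderiv ℝ (potential p) m Z * (X.1 * Y.1) -
      (fderiv ℝ (potential p') (φ m) (fderiv ℝ φ m X) *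
          ((fderiv ℝ φ m Y).1 * (fderiv ℝ φ m Z).1) +
        fderiv ℝ (potential p') (φ m) (fderiv ℝ φ m Y) *
          ((fderiv ℝ φ m X).1 * (fderiv ℝ φ m Z).1) -
        fderiv ℝ (potential p') (φ m) (fderiv ℝ φ m Z) *
          ((fderiv ℝ φ m X).1 * (fderiv ℝ φ m Y).1)) := by
  -- The combination `h1 + h2 - h3`: by symmetry of the second derivative, the terms with D²φ(X, Z)
  -- and D²φ(Y, Z) cancel.
  have h1 := hφ.fderiv_pullback hU hU' hp hp' hm Y Z X
  have h2 := hφ.fderiv_pullback hU hU' hp hp' hm X Z Y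
  have h3 := hφ.fderiv_pullback hU hU' hp hp' hm X Y Z
  rw [hφ.symm_second hU hm Y X, brinkmannMetric_comm _ (fderiv ℝ φ m X)] at h2
  rw [hφ.symm_second hU hm Z X, hφ.symm_second hU hm Z Y,
    brinkmannMetric_comm _ (fderiv ℝ φ m X)] at h3
  rw [brinkmannMetric_comm _ (fderiv ℝ φ m Y)] at h1
  linarith

/-! ### Integrating vanishing derivatives. -/

/-- A function with vanishing derivative on the domain is constant there. -/
theorem eq_of_fderiv_eq_zero {F : Type*} [NormedAddCommGroup F] [NormedSpace ℝ F]
    (hU : IsOpenInterval U) {k : Coord n → F} {k' : Coord n → Coord n →L[ℝ] F}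
    (hk : ∀ m ∈ domain n U, HasFDerivAt k (k' m) m)
    (h0 : ∀ m ∈ domain n U, ∀ Z, k' m Z = 0) {m q : Coord n}
    (hm : m ∈ domain n U) (hq : q ∈ domain n U) : k m = k q :=
  (isOpen_domain hU.isOpen).is_const_of_fderiv_eq_zero (convex_domain hU.ordConnected).isPreconnected
    (fun m hm => (hk m hm).differentiableAt.differentiableWithinAt)
    (fun m hm => by
      rw [(hk m hm).fderiv]
      exact ContinuousLinearMap.ext (h0 m hm)) hm hq

theorem add_mem_domain {m w : Coord n} (hw : w.1 = 0) (hm : m ∈ domain n U) :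
    m + w ∈ domain n U := by
  change m.1 + w.1 ∈ U
  rw [hw, add_zero]
  exact hm

/-- A function with vanishing derivative in a direction `w` tangent to the level sets of `u` is
invariant under the translation by `w`. -/
theorem eq_of_fderiv_apply_eq_zero {F : Type*} [NormedAddCommGroup F] [NormedSpace ℝ F]
    {k : Coord n → F} {k' : Coord n → Coord n →L[ℝ] F}
    (hk : ∀ m ∈ domain n U, HasFDerivAt k (k' m) m) {w : Coord n} (hw : w.1 = 0)
    (h0 : ∀ m ∈ domain n U, k' m w = 0) {m : Coord n} (hm : m ∈ domain n U) :
    k (m + w) = k m := by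
  have hd : ∀ t : ℝ, HasDerivAt (fun t : ℝ => k (m + t • w)) 0 t := fun t => by
    have ht : m + t • w ∈ domain n U := add_mem_domain (by simp [hw]) hm
    have hl : HasDerivAt (fun t : ℝ => m + t • w) w t := by
      simpa using ((hasDerivAt_id t).smul_const w).const_add m
    have := (hk _ ht).comp_hasDerivAt t hl
    rwa [h0 _ ht] at this
  have := is_const_of_deriv_eq_zero (fun t => (hd t).differentiableAt) (fun t => (hd t).deriv) 1 0
  simpa using this

/-- Invariance of k under translation by w passes to its derivative. With k a first derivative of φ,
this compares second derivatives at two points without any third derivative. -/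
theorem derivative_eq_of_fderiv_apply_eq_zero {F : Type*} [NormedAddCommGroup F] [NormedSpace ℝ F]
    (hU : IsOpen U) {k : Coord n → F} {k' : Coord n → Coord n →L[ℝ] F}
    (hk : ∀ m ∈ domain n U, HasFDerivAt k (k' m) m) {w : Coord n} (hw : w.1 = 0)
    (h0 : ∀ m ∈ domain n U, k' m w = 0) {m : Coord n} (hm : m ∈ domain n U) :
    k' (m + w) = k' m := by
  have h1 := ((hasFDerivAt_comp_add_right w).2 (hk _ (add_mem_domain hw hm))).congr_of_eventuallyEq (f₁ := k) (by
    filter_upwards [(isOpen_domain hU).mem_nhds hm] with q hq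
    exact (eq_of_fderiv_apply_eq_zero hk hw h0 hq).symm)
  exact h1.unique (hk m hm)

/-! ### The function ū ∘ φ. -/

theorem IsIsometry.exists_preimage (hU : IsOpen U) (hU' : IsOpen U')
    (hφ : IsIsometry U p U' p' φ) {m : Coord n} (hm : m ∈ domain n U) (Y : Coord n) :
    ∃ W, fderiv ℝ φ m W = Y := by
  obtain ⟨ψ, -, -, h⟩ := hφ.exists_inverse hU hU'
  exact ⟨_, h m hm Y⟩

/-- In the target, ∂_v̄ is the gradient of ū; hence W is the gradient of ū ∘ φ. -/
theorem fst_of_fderiv_eq_dv (hφ : IsIsometry U p U' p' φ) {m W : Coord n}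
    (hm : m ∈ domain n U) (hW : fderiv ℝ φ m W = (0, 1, 0)) (Y : Coord n) :
    brinkmannMetric p m Y W = (fderiv ℝ φ m Y).1 := by
  rw [← hφ.pullback m hm, hW, brinkmannMetric_dv]

/-- The Hessian of the function `u ∘ φ`. -/
theorem IsIsometry.hessian_fst (hU : IsOpen U) (hU' : IsOpen U')
    (hp : IsProfile U p) (hp' : IsProfile U' p') (hφ : IsIsometry U p U' p' φ)
    {m W : Coord n} (hm : m ∈ domain n U) (hW : fderiv ℝ φ m W = (0, 1, 0)) (X Y : Coord n) :
    2 * (fderiv ℝ (fderiv ℝ φ) m X Y).1 =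
      fderiv ℝ (potential p) m X * (Y.1 * W.1) + fderiv ℝ (potential p) m Y * (X.1 * W.1) -
        fderiv ℝ (potential p) m W * (X.1 * Y.1) := by
  have h := hφ.koszul hU hU' hp hp' hm X Y W
  -- All target terms vanish: ∂_v̄ has no ū-component and the target potential does not depend on
  -- v̄.
  rw [hW, brinkmannMetric_dv,
    hp'.fderiv_potential hU' (hφ.diffeo.bijOn.mapsTo hm) (0, 1, 0) rfl] at h
  simpa using h

/-- The derivative of `u ∘ φ` in the direction of `v` is constant. -/
theorem IsIsometry.fst_dv_eq (hU : IsOpenInterval U) (hU' : IsOpen U')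
    (hp : IsProfile U p) (hp' : IsProfile U' p') (hφ : IsIsometry U p U' p' φ)
    {m q : Coord n} (hm : m ∈ domain n U) (hq : q ∈ domain n U) :
    (fderiv ℝ φ m (0, 1, 0)).1 = (fderiv ℝ φ q (0, 1, 0)).1 := by
  refine eq_of_fderiv_eq_zero hU (fun m hm => (hφ.hasFDerivAt_apply hU.isOpen hm (0, 1, 0)).fst)
    (fun m hm Z => ?_) hm hq
  obtain ⟨W, hW⟩ := hφ.exists_preimage hU.isOpen hU' hm (0, 1, 0)
  have h := hφ.hessian_fst hU.isOpen hU' hp hp' hm hW Z (0, 1, 0)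
  rw [hp.fderiv_potential hU.isOpen hm (0, 1, 0) rfl] at h
  simpa using h

/-- If `u ∘ φ` depends on `v` then the profile vanishes. -/
theorem IsIsometry.profile_eq_zero (hU : IsOpen U) (hU' : IsOpen U')
    (hp : IsProfile U p) (hp' : IsProfile U' p') (hφ : IsIsometry U p U' p' φ)
    (hc : ∀ m ∈ domain n U, (fderiv ℝ φ m (0, 1, 0)).1 ≠ 0) :
    ∀ u ∈ U, p u = 0 := by
  intro u hu
  have key : ∀ ξ x : Fin n → ℝ, ξ ⬝ᵥ (p u *ᵥ x) = 0 := by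
    intro ξ x
    have hk := fun m (hm : m ∈ domain n U) => (hφ.hasFDerivAt_apply hU hm (0, 0, ξ)).fst
    have hm : ((u, 0, 0) : Coord n) ∈ domain n U := hu
    have hx : ((u, 0, x) : Coord n) ∈ domain n U := hu
    -- The Hessian of ū ∘ φ vanishes on pairs of x-directions, so ∂_u ∂_ξ (ū ∘ φ) agrees at x and at
    -- 0. By `h2` it equals c ξᵀ p x, which is zero at x = 0.
    have h1 := derivative_eq_of_fderiv_apply_eq_zero hU hk (w := (0, 0, x)) rfl (fun m hm => by
      obtain ⟨W, hW⟩ := hφ.exists_preimage hU hU' hm (0, 1, 0)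
      have h := hφ.hessian_fst hU hU' hp hp' hm hW (0, 0, x) (0, 0, ξ)
      simpa using h) hm
    have h2 : ∀ m ∈ domain n U, (fderiv ℝ (fderiv ℝ φ) m (1, 0, 0) (0, 0, ξ)).1 =
        (ξ ⬝ᵥ (p m.1 *ᵥ m.2.2)) * (fderiv ℝ φ m (0, 1, 0)).1 := by
      intro m hm
      obtain ⟨W, hW⟩ := hφ.exists_preimage hU hU' hm (0, 1, 0)
      have h := hφ.hessian_fst hU hU' hp hp' hm hW (1, 0, 0) (0, 0, ξ)
      rw [hp.fderiv_potential hU hm (0, 0, ξ) rfl] at h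
      have h' := fst_of_fderiv_eq_dv hφ hm hW (0, 1, 0)
      rw [brinkmannMetric_comm, brinkmannMetric_dv] at h'
      rw [← h']
      simp at h
      linarith
    have h3 := congrArg (fun L : Coord n →L[ℝ] ℝ => L (1, 0, 0)) h1
    simp only [ContinuousLinearMap.comp_apply, ContinuousLinearMap.flip_apply,
      ContinuousLinearMap.coe_fst'] at h3
    rw [show ((u, 0, 0) : Coord n) + (0, 0, x) = (u, 0, x) by simp, h2 _ hx, h2 _ hm] at h3
    simpa [hc _ hx] using h3
  ext i j
  simpa using key (Pi.single i 1) (Pi.single j 1)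

/-- If `u ∘ φ` does not depend on `v` then it is an affine function of `u`. -/
theorem IsIsometry.exists_affine (hU : IsOpenInterval U) (hU' : IsOpen U')
    (hp : IsProfile U p) (hp' : IsProfile U' p') (hφ : IsIsometry U p U' p' φ)
    (hc : ∀ m ∈ domain n U, (fderiv ℝ φ m (0, 1, 0)).1 = 0) :
    ∃ a u₀ : ℝ, a ≠ 0 ∧ (∀ m ∈ domain n U, (φ m).1 = a * (m.1 - u₀)) ∧
      ∀ m ∈ domain n U, (∀ X, (fderiv ℝ φ m X).1 = a * X.1) ∧
        fderiv ℝ φ m (0, a, 0) = (0, 1, 0) := by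
  have hW : ∀ m ∈ domain n U, ∃ b : ℝ, fderiv ℝ φ m (0, b, 0) = (0, 1, 0) ∧
      ∀ X, (fderiv ℝ φ m X).1 = b * X.1 := by
    intro m hm
    obtain ⟨W, hW⟩ := hφ.exists_preimage hU.isOpen hU' hm (0, 1, 0)
    have h1 := fst_of_fderiv_eq_dv hφ hm hW (0, 1, 0)
    rw [brinkmannMetric_comm, brinkmannMetric_dv, hc m hm] at h1
    -- W is null with zero u-component, so its x-part has Euclidean norm zero.
    have h2 := fst_of_fderiv_eq_dv hφ hm hW W
    rw [hW] at h2
    simp [brinkmannMetric, h1, dotProduct_self_eq_zero] at h2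
    have hW' : W = (0, W.2.1, 0) := Prod.ext h1 (Prod.ext rfl h2)
    refine ⟨W.2.1, by rw [← hW', hW], fun X => ?_⟩
    have h3 := fst_of_fderiv_eq_dv hφ hm hW X
    rw [← h3, hW']
    simp [brinkmannMetric, mul_comm]
  have hconst : ∀ m ∈ domain n U, ∀ q ∈ domain n U,
      (fderiv ℝ φ m (1, 0, 0)).1 = (fderiv ℝ φ q (1, 0, 0)).1 := by
    intro m hm q hq
    refine eq_of_fderiv_eq_zero hU
      (fun m hm => (hφ.hasFDerivAt_apply hU.isOpen hm (1, 0, 0)).fst) (fun m hm Z => ?_) hm hq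
    obtain ⟨b, hb, -⟩ := hW m hm
    have h := hφ.hessian_fst hU.isOpen hU' hp hp' hm hb Z (1, 0, 0)
    rw [hp.fderiv_potential hU.isOpen hm (0, b, 0) rfl] at h
    simpa using h
  obtain ⟨u, hu⟩ := hU.nonempty
  have hq : ((u, 0, 0) : Coord n) ∈ domain n U := hu
  obtain ⟨a, ha, ha'⟩ := hW _ hq
  have hall : ∀ m ∈ domain n U, (∀ X, (fderiv ℝ φ m X).1 = a * X.1) ∧
      fderiv ℝ φ m (0, a, 0) = (0, 1, 0) := by
    intro m hm
    obtain ⟨b, hb, hb'⟩ := hW m hm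
    have := hconst m hm _ hq
    rw [hb', ha'] at this
    obtain rfl : b = a := by simpa using this
    exact ⟨hb', hb⟩
  have hane : a ≠ 0 := by
    rintro rfl
    have h0 : fderiv ℝ φ (u, 0, 0) 0 = (0, 1, 0) := ha
    rw [map_zero] at h0
    simpa using congrArg (fun X : Coord n => X.2.1) h0
  refine ⟨a, u - (φ (u, 0, 0)).1 / a, hane, fun m hm => ?_, hall⟩
  have h := eq_of_fderiv_eq_zero hU (k := fun m => (φ m).1 - a * m.1)
    (fun m hm => (hφ.differentiableAt hU.isOpen hm).hasFDerivAt.fst.sub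
      (hasFDerivAt_fst.const_mul a)) (fun m hm Z => by simp [(hall m hm).1]) hm hq
  field_simp
  linarith

/-- If `u ∘ φ` depends on `v` then it is onto. -/
theorem IsIsometry.eq_univ (hU : IsOpenInterval U) (hU' : IsOpen U')
    (hp : IsProfile U p) (hp' : IsProfile U' p') (hφ : IsIsometry U p U' p' φ)
    (hc : ∀ m ∈ domain n U, (fderiv ℝ φ m (0, 1, 0)).1 ≠ 0) : U' = Set.univ := by
  obtain ⟨u, hu⟩ := hU.nonempty
  have hq : ∀ t : ℝ, ((u, t, 0) : Coord n) ∈ domain n U := fun t => hu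
  set c := (fderiv ℝ φ (u, 0, 0) (0, 1, 0)).1 with hcdef
  -- Along a v-line, ū ∘ φ is affine with slope c ≠ 0, hence takes every real value.
  have hd : ∀ t : ℝ, HasDerivAt (fun t : ℝ => (φ (u, t, 0)).1 - c * t) 0 t := fun t => by
    have hl : HasDerivAt (fun t : ℝ => ((u, t, 0) : Coord n)) (0, 1, 0) t :=
      (hasDerivAt_const t u).prodMk ((hasDerivAt_id t).prodMk (hasDerivAt_const t _))
    have h := (hφ.differentiableAt hU.isOpen (hq t)).hasFDerivAt.fst.comp_hasDerivAt t hl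
    have h' := h.sub ((hasDerivAt_id t).const_mul c)
    have e := hφ.fst_dv_eq hU hU' hp hp' (hq t) (hq 0)
    refine h'.congr_deriv ?_
    change (fderiv ℝ φ (u, t, 0) (0, 1, 0)).1 - c * 1 = 0
    rw [e, hcdef, mul_one, sub_self]
  refine Set.eq_univ_of_forall fun w => ?_
  have h := is_const_of_deriv_eq_zero (fun t => (hd t).differentiableAt) (fun t => (hd t).deriv)
    ((w - (φ (u, 0, 0)).1) / c) 0
  have hc0 : c ≠ 0 := hc _ (hq 0)
  rw [mul_div_cancel₀ _ hc0] at h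
  have hw : (φ (u, (w - (φ (u, 0, 0)).1) / c, 0)).1 = w := by linarith
  rw [← hw]
  exact hφ.diffeo.bijOn.mapsTo (hq _)

/-! ### The component x̄ ∘ φ and the matching of profiles. -/

/-- The Hessian of the component `x ∘ φ` of an isometry that rescales `u`. -/
theorem IsIsometry.hessian_snd (hU : IsOpen U) (hU' : IsOpen U')
    (hp : IsProfile U p) (hp' : IsProfile U' p') (hφ : IsIsometry U p U' p' φ) {a : ℝ}
    (ha : a ≠ 0) {m : Coord n} (hm : m ∈ domain n U)
    (hD : ∀ X, (fderiv ℝ φ m X).1 = a * X.1) {Z : Coord n} {ζ : Fin n → ℝ}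
    (hZ : fderiv ℝ φ m Z = (0, 0, ζ)) (X Y : Coord n) :
    (fderiv ℝ (fderiv ℝ φ) m X Y).2.2 ⬝ᵥ ζ = (Z.2.2 ⬝ᵥ (p m.1 *ᵥ m.2.2) -
      a ^ 2 * (ζ ⬝ᵥ (p' (φ m).1 *ᵥ (φ m).2.2))) * (X.1 * Y.1) := by
  have hZ1 : Z.1 = 0 := by
    have := hD Z
    rw [hZ] at this
    simpa [ha] using this.symm
  have h := hφ.koszul hU hU' hp hp' hm X Y Z
  rw [hZ, brinkmannMetric_dx, hp'.fderiv_potential hU' (hφ.diffeo.bijOn.mapsTo hm) (0, 0, ζ) rfl,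
    hp.fderiv_potential hU hm Z hZ1, hZ1, hD, hD] at h
  simp only [mul_zero, add_zero] at h
  linear_combination (-1 / 2 : ℝ) * h

theorem IsIsometry.hessian_snd_eq_zero (hU : IsOpen U) (hU' : IsOpen U')
    (hp : IsProfile U p) (hp' : IsProfile U' p') (hφ : IsIsometry U p U' p' φ) {a : ℝ}
    (ha : a ≠ 0) {m : Coord n} (hm : m ∈ domain n U)
    (hD : ∀ X, (fderiv ℝ φ m X).1 = a * X.1) (X Y : Coord n) (hXY : X.1 * Y.1 = 0) :
    (fderiv ℝ (fderiv ℝ φ) m X Y).2.2 = 0 := by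
  -- Testing the vector against itself suffices, since the dot product is definite.
  obtain ⟨Z, hZ⟩ := hφ.exists_preimage hU hU' hm
    (0, 0, (fderiv ℝ (fderiv ℝ φ) m X Y).2.2)
  have h := hφ.hessian_snd hU hU' hp hp' ha hm hD hZ X Y
  rw [hXY, mul_zero] at h
  exact dotProduct_self_eq_zero.1 h

theorem IsIsometry.exists_isMatch_of_affine (hU : IsOpenInterval U) (hU' : IsOpen U')
    (hp : IsProfile U p) (hp' : IsProfile U' p') (hφ : IsIsometry U p U' p' φ)
    (hc : ∀ m ∈ domain n U, (fderiv ℝ φ m (0, 1, 0)).1 = 0) :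
    ∃ (a u₀ : ℝ) (γ : Matrix (Fin n) (Fin n) ℝ), IsMatch U p U' p' a u₀ γ := by
  obtain ⟨a, u₀, ha, hfst, hall⟩ := hφ.exists_affine hU hU' hp hp' hc
  obtain ⟨u₁, hu₁⟩ := hU.nonempty
  have hq : ((u₁, 0, 0) : Coord n) ∈ domain n U := hu₁
  set L := fderiv ℝ φ (u₁, 0, 0) with hL
  let ι : (Fin n → ℝ) →ₗ[ℝ] Coord n := LinearMap.inr ℝ ℝ _ ∘ₗ LinearMap.inr ℝ ℝ _
  let π : Coord n →ₗ[ℝ] (Fin n → ℝ) := LinearMap.snd ℝ ℝ _ ∘ₗ LinearMap.snd ℝ ℝ _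
  let γ : Matrix (Fin n) (Fin n) ℝ := LinearMap.toMatrix' (π ∘ₗ (L : Coord n →ₗ[ℝ] Coord n) ∘ₗ ι)
  have hγ₁ : ∀ ξ, γ *ᵥ ξ = (L (0, 0, ξ)).2.2 := fun ξ => by
    rw [← Matrix.toLin'_apply, Matrix.toLin'_toMatrix']
    rfl
  have hγ : ∀ m ∈ domain n U, ∀ ξ, (fderiv ℝ φ m (0, 0, ξ)).2.2 = γ *ᵥ ξ := fun m hm ξ => by
    rw [hγ₁]
    exact eq_of_fderiv_eq_zero hU
      (fun m hm => (hφ.hasFDerivAt_apply hU.isOpen hm (0, 0, ξ)).snd.snd)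
      (fun m hm Z => hφ.hessian_snd_eq_zero hU.isOpen hU' hp hp' ha hm (hall m hm).1
        Z (0, 0, ξ) (by simp)) hm hq
  have horth : ∀ ξ η, (γ *ᵥ ξ) ⬝ᵥ (γ *ᵥ η) = ξ ⬝ᵥ η := fun ξ η => by
    have h := hφ.pullback _ hq (0, 0, ξ) (0, 0, η)
    simp only [brinkmannMetric, (hall _ hq).1, hγ _ hq] at h
    simpa using h
  have hγγ : γᵀ * γ = 1 := by
    ext i j
    have h := horth (Pi.single i 1) (Pi.single j 1)
    rw [mulVec_dotProduct_mulVec, Matrix.mulVec_mulVec] at h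
    simpa [Matrix.one_apply, Pi.single_apply, eq_comm] using h
  have hsnd : ∀ u ∈ U, ∀ x, (φ (u, 0, x)).2.2 = (φ (u, 0, 0)).2.2 + γ *ᵥ x := by
    intro u hu x
    have h := eq_of_fderiv_apply_eq_zero (U := U) (k := fun m => (φ m).2.2 - (L m).2.2)
      (w := (0, 0, x)) (m := (u, 0, 0))
      (fun m hm => (hφ.differentiableAt hU.isOpen hm).hasFDerivAt.snd.snd.sub
        L.hasFDerivAt.snd.snd) rfl
      (fun m hm => by
        change (fderiv ℝ φ m (0, 0, x)).2.2 - (L (0, 0, x)).2.2 = 0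
        rw [hγ m hm, hγ₁, sub_self]) hu
    simp only [map_add, Prod.snd_add] at h
    rw [show ((u, 0, 0) : Coord n) + (0, 0, x) = (u, 0, x) by simp, ← hγ₁] at h
    rw [sub_eq_sub_iff_add_eq_add] at h
    have h' : (φ (u, 0, x)).2.2 + (L (u, 0, 0)).2.2 =
      (φ (u, 0, 0)).2.2 + γ *ᵥ x + (L (u, 0, 0)).2.2 := by rw [h]; abel
    exact add_right_cancel h'
  have hess : ∀ m ∈ domain n U, ∀ η,
      (fderiv ℝ (fderiv ℝ φ) m (1, 0, 0) (1, 0, 0)).2.2 ⬝ᵥ (γ *ᵥ η) =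
        η ⬝ᵥ (p m.1 *ᵥ m.2.2) -
          a ^ 2 * ((γ *ᵥ η) ⬝ᵥ (p' (a * (m.1 - u₀)) *ᵥ (φ m).2.2)) := by
    intro m hm η
    -- Subtracting a multiple of (0, a, 0), which maps to ∂_v̄, clears the v̄-component of the image
    -- and leaves the x-part η intact.
    have hZ : fderiv ℝ φ m ((0, 0, η) - (fderiv ℝ φ m (0, 0, η)).2.1 • (0, a, 0)) =
        (0, 0, γ *ᵥ η) := by
      rw [map_sub, map_smul, (hall m hm).2]
      refine Prod.ext ?_ (Prod.ext ?_ ?_)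
      · simp [(hall m hm).1]
      · simp
      · simp [hγ m hm]
    have h := hφ.hessian_snd hU.isOpen hU' hp hp' ha hm (hall m hm).1 hZ (1, 0, 0) (1, 0, 0)
    rw [h, hfst m hm]
    simp
  refine ⟨a, u₀, γ, ha, (Matrix.mem_orthogonalGroup_iff' _ _).2 hγγ, ?_, ?_⟩
  · ext w
    constructor
    · rintro ⟨u, hu, rfl⟩
      have hm : ((u, 0, 0) : Coord n) ∈ domain n U := hu
      have h : (φ (u, 0, 0)).1 ∈ U' := hφ.diffeo.bijOn.mapsTo hm
      rwa [hfst _ hm] at h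
    · intro hw
      have hw' : ((w, 0, 0) : Coord n) ∈ domain n U' := hw
      obtain ⟨m, hm, h⟩ := hφ.diffeo.bijOn.surjOn hw'
      refine ⟨m.1, hm, ?_⟩
      simp only [← hfst m hm, h]
  · intro u hu
    have key : ∀ η x : Fin n → ℝ, a ^ 2 * (η ⬝ᵥ ((γᵀ * p' (a * (u - u₀)) * γ) *ᵥ x)) =
        η ⬝ᵥ (p u *ᵥ x) := by
      intro η x
      have hm : ((u, 0, 0) : Coord n) ∈ domain n U := hu
      have hx : ((u, 0, x) : Coord n) ∈ domain n U := hu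
      have h1 := derivative_eq_of_fderiv_apply_eq_zero hU.isOpen
        (fun m hm => (hφ.hasFDerivAt_apply hU.isOpen hm (1, 0, 0)).snd.snd) (w := (0, 0, x)) rfl
        (fun m hm => hφ.hessian_snd_eq_zero hU.isOpen hU' hp hp' ha hm (hall m hm).1
          (0, 0, x) (1, 0, 0) (by simp)) hm
      have h2 : (fderiv ℝ (fderiv ℝ φ) (u, 0, x) (1, 0, 0) (1, 0, 0)).2.2 =
          (fderiv ℝ (fderiv ℝ φ) (u, 0, 0) (1, 0, 0) (1, 0, 0)).2.2 := by
        rw [show ((u, 0, 0) : Coord n) + (0, 0, x) = (u, 0, x) by simp] at h1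
        exact congrArg (fun L : Coord n →L[ℝ] (Fin n → ℝ) => L (1, 0, 0)) h1
      have h3 := hess _ hx η
      -- The unknown translation φ(u, 0, 0) contributes equally on both sides and cancels; the part
      -- linear in x is the profile relation.
      rw [h2, hess _ hm η, hsnd u hu x] at h3
      simp only [Matrix.mulVec_add, dotProduct_add, Matrix.mulVec_zero, dotProduct_zero] at h3
      rw [Matrix.mul_assoc, ← Matrix.mulVec_mulVec, ← Matrix.mulVec_mulVec,
        ← mulVec_dotProduct_mulVec]
      linarith
    ext i j
    simpa using key (Pi.single i 1) (Pi.single j 1)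

/-- Isometric Brinkmann metrics have matching profiles. -/
theorem IsIsometry.exists_isMatch (hU : IsOpenInterval U) (hU' : IsOpenInterval U')
    (hp : IsProfile U p) (hp' : IsProfile U' p') (hφ : IsIsometry U p U' p' φ) :
    ∃ (a u₀ : ℝ) (γ : Matrix (Fin n) (Fin n) ℝ), IsMatch U p U' p' a u₀ γ := by
  obtain ⟨u₁, hu₁⟩ := hU.nonempty
  have hq : ((u₁, 0, 0) : Coord n) ∈ domain n U := hu₁
  obtain ⟨w₁, hw₁⟩ := hU'.nonempty
  have hr : ((w₁, 0, 0) : Coord n) ∈ domain n U' := hw₁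
  by_cases hc : (fderiv ℝ φ (u₁, 0, 0) (0, 1, 0)).1 = 0
  · exact hφ.exists_isMatch_of_affine hU hU'.isOpen hp hp' fun m hm => by
      rw [hφ.fst_dv_eq hU hU'.isOpen hp hp' hm hq, hc]
  obtain ⟨ψ, hψ, -, -⟩ := hφ.exists_inverse hU.isOpen hU'.isOpen
  by_cases hd : (fderiv ℝ ψ (w₁, 0, 0) (0, 1, 0)).1 = 0
  · obtain ⟨a, u₀, γ, h⟩ := hψ.exists_isMatch_of_affine hU' hU.isOpen hp' hp fun m hm => by
      rw [hψ.fst_dv_eq hU' hU.isOpen hp' hp hm hr, hd]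
    exact ⟨_, _, _, h.symm⟩
  have hc' : ∀ m ∈ domain n U, (fderiv ℝ φ m (0, 1, 0)).1 ≠ 0 := fun m hm => by
    rwa [hφ.fst_dv_eq hU hU'.isOpen hp hp' hm hq]
  have hd' : ∀ m ∈ domain n U', (fderiv ℝ ψ m (0, 1, 0)).1 ≠ 0 := fun m hm => by
    rwa [hψ.fst_dv_eq hU' hU.isOpen hp' hp hm hr]
  have e' := hφ.eq_univ hU hU'.isOpen hp hp' hc'
  have e := hψ.eq_univ hU' hU.isOpen hp' hp hd'
  have z := hφ.profile_eq_zero hU.isOpen hU'.isOpen hp hp' hc'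
  have z' := hψ.profile_eq_zero hU'.isOpen hU.isOpen hp' hp hd'
  -- Both intervals are ℝ and both profiles vanish, so the identity is a match.
  refine ⟨1, 0, 1, one_ne_zero, one_mem _, by simp [e, e'], fun u hu => ?_⟩
  rw [z u hu, z' _ (e' ▸ Set.mem_univ _)]
  simp

end PlaneWave

theorem mainTheorem4 (n : ℕ) (U U' : Set ℝ)
    (hU : PlaneWave.IsOpenInterval U) (hU' : PlaneWave.IsOpenInterval U')
    (p p' : ℝ → Matrix (Fin n) (Fin n) ℝ)
    (hp : PlaneWave.IsProfile U p) (hp' : PlaneWave.IsProfile U' p') :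
    ((∃ φ : PlaneWave.Coord n → PlaneWave.Coord n, PlaneWave.IsIsometry U p U' p' φ) ↔
      ∃ (a u₀ : ℝ) (γ : Matrix (Fin n) (Fin n) ℝ), PlaneWave.IsMatch U p U' p' a u₀ γ) ∧
    ∀ (a u₀ : ℝ) (γ : Matrix (Fin n) (Fin n) ℝ), PlaneWave.IsMatch U p U' p' a u₀ γ →
      PlaneWave.IsIsometry U p U' p' (PlaneWave.affineMap a u₀ γ) ∧
      ∀ φ : PlaneWave.Coord n → PlaneWave.Coord n,
        PlaneWave.IsIsometry U p U' p' φ ↔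
          ∃ α : PlaneWave.Coord n → PlaneWave.Coord n,
            PlaneWave.IsAutomorphism U p α ∧
            Set.EqOn φ (PlaneWave.affineMap a u₀ γ ∘ α) (PlaneWave.domain n U) := by
  refine ⟨⟨fun ⟨φ, hφ⟩ => hφ.exists_isMatch hU hU' hp hp',
    fun ⟨a, u₀, γ, h⟩ => ⟨_, h.isIsometry⟩⟩, fun a u₀ γ h => ⟨h.isIsometry, fun φ => ⟨fun hφ => ?_, ?_⟩⟩⟩
  -- The automorphism is the inverse affine map composed with φ.
  · exact ⟨_, h.symm.isIsometry.comp hU.isOpen hU'.isOpen hφ,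
      fun m _ => (h.affineMap_inverse' (φ m)).symm⟩
  · rintro ⟨α, hα, hφ⟩
    exact (h.isIsometry.comp hU.isOpen hU.isOpen hα).congr hU.isOpen hφ
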